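/- Identify each similarity class of (nondegenerate) triangles (reflections allowed) with the unique point $w$ of $D=\{w\in\mathbb{C}:\operatorname{Re} w\le\frac12,\ \operatorname{Im} w>0,\ |w-1|\le 1\}$ such that the triangle with vertices $0,1,w$ belongs to the class. For $w\in D$ let $L(w),R(w)\in D$ be the classes of the triangles $(0,\frac12,w)$ and $(\frac12,1,w)$ into which $(0,1,w)$ is cut by the median to its longest edge $[0,1]$. Let $\mathrm{LEB}(w)$ be the smallest subset of $D$ that contains $w$ and is closed under $L$ and $R$. Let $\mathrm{I}=\{w\in D:\operatorname{Re} w\ge\frac14,\ |w-\frac12|\ge\frac12\}$ and $A=\mathrm{I}\cup R(\mathrm{I})$. A terminal quadruple is a set $\mathrm{LEB}(u)$ with $u\in A$ (its elements may be fewer than four). Fix an initial triangle $z\in D$. In one step of longest edge bisection every triangle of the current mesh, which at step $0$ consists of the triangle $(0,1,z)$ alone, is cut into two by the median to a longest edge; if a longest edge is not unique, one is selected by an arbitrary fixed rule. For $j\ge 0$ and $c\in\mathrm{LEB}(z)$ let $w_j(c)$ be the proportion of the area of the initial triangle that is occupied, after $j$ steps, by triangles of the class $c$. Call $c\in\mathrm{LEB}(z)$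 terminal if it lies in a terminal quadruple $\mathrm{LEB}(u)$ with $u\in A\cap\mathrm{LEB}(z)$. Then $\mathrm{LEB}(z)$ is finite, $w_j=(w_j(c))_{c\in\mathrm{LEB}(z)}$ is a probability vector for every $j$, and the following hold. 1. The limits $w_{even}=\lim_{j\to\infty}w_{2j}$ and $w_{odd}=\lim_{j\to\infty}w_{2j+1}$ exist, and their non-zero entries are those of the terminal classes, in the following sense: for $c\in\mathrm{LEB}(z)$, at least one of $w_{even}(c)$, $w_{odd}(c)$ is non-zero if and only if $c$ is terminal; more precisely, $w_{even}(c)\ne 0$ (respectively $w_{odd}(c)\neq 0$) if and only if $c$ is terminal and $w_k(c)\ne 0$ for some even (respectively odd) $k$. 2. There are $\xi\in(0,1)$ and a constant $C$ (which may depend on $z$) such that for every $j\ge 0$ the area of the initial triangle that is occupied, after $j$ steps, by triangles whose class is not terminal is at most $C\xi^j$. -/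

import Mathlib

open Filter Topology MeasureTheory

namespace LongestEdgeBisection

/-- A triangle in the plane `ℂ`, given by its three vertices. -/
abbrev Triangle : Type := Fin 3 → ℂ

/-- The normalized region `D`. The point `z ∈ D` stands for the similarity class of the triangle
with vertices `0, 1, z`. -/
def normalizedRegion : Set ℂ :=
  {z | z.re ≤ 1 / 2 ∧ 0 < z.im ∧ ‖z - 1‖ ≤ 1}

/-- The triangle `T` belongs to the similarity class represented by `w ∈ D`: for some labelling of
its vertices it is similar (possibly with a reflection) to the triangle `0, 1, w`. -/
def HasShape (T : Triangle) (w : ℂ) : Prop :=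
  w ∈ normalizedRegion ∧ ∃ σ : Equiv.Perm (Fin 3), Similar (T ∘ σ) ![0, 1, w]

/-- The left half of the normalized triangle `0, 1, w`, cut by the median to its edge `[0, 1]`. -/
noncomputable def leftHalf (w : ℂ) : Triangle := ![0, 1 / 2, w]

/-- The right half of the normalized triangle `0, 1, w`, cut by the median to its edge `[0, 1]`. -/
noncomputable def rightHalf (w : ℂ) : Triangle := ![1 / 2, 1, w]

/-- The orbit `LEB(z)`: the smallest set of similarity classes that contains `z` and, with each
class `w`, the classes `L(w)` and `R(w)` of the two halves of `0, 1, w`. -/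
def orbit (z : ℂ) : Set ℂ :=
  {w | Relation.ReflTransGen
    (fun u v => HasShape (leftHalf u) v ∨ HasShape (rightHalf u) v) z w}

/-- Region `I` of the subdivision of `D`. -/
def regionI : Set ℂ :=
  {z | z ∈ normalizedRegion ∧ 1 / 4 ≤ z.re ∧ 1 / 2 ≤ ‖z - 1 / 2‖}

/-- The terminal region `A = I ∪ R(I)`. -/
def terminalRegion : Set ℂ :=
  regionI ∪ {w | ∃ u ∈ regionI, HasShape (rightHalf u) w}

/-- The terminal quadruples that arise from `z`: the orbits `LEB(u)` of the classes `u` in the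
terminal region that occur in `LEB(z)`. -/
def terminalQuadruples (z : ℂ) : Set (Set ℂ) :=
  {Q | ∃ u ∈ orbit z, u ∈ terminalRegion ∧ Q = orbit u}

/-- The similarity classes that lie in some terminal quadruple arising from `z`. -/
def terminalClasses (z : ℂ) : Set ℂ := ⋃₀ terminalQuadruples z

/-- The edge of `T` opposite to the vertex `i`, i.e. the edge joining the two other vertices,
is a longest edge of `T`. -/
def IsLongestEdge (T : Triangle) (i : Fin 3) : Prop :=
  ∀ k : Fin 3, dist (T (k + 1)) (T (k + 2)) ≤ dist (T (i + 1)) (T (i + 2))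

/-- The two triangles into which `T` is cut by the median from the vertex `i`. -/
noncomputable def bisect (T : Triangle) (i : Fin 3) : Multiset Triangle :=
  {![T i, T (i + 1), midpoint ℝ (T (i + 1)) (T (i + 2))],
   ![T i, midpoint ℝ (T (i + 1)) (T (i + 2)), T (i + 2)]}

/-- The triangles of the mesh that is obtained from `T` by `j` steps of longest edge bisection.
In each step every triangle `S` of the mesh is cut by the median from the vertex `e S`; here `e`
is a rule that selects a longest edge of each triangle, given by its opposite vertex. -/
noncomputable def mesh (e : Triangle → Fin 3) (T : Triangle) : ℕ → Multiset Triangle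
  | 0 => {T}
  | j + 1 => (mesh e T j).bind fun S => bisect S (e S)

/-- The area of a triangle: the Lebesgue measure of the convex hull of its vertices. -/
noncomputable def area (T : Triangle) : ℝ :=
  volume.real (convexHull ℝ (Set.range T))

open Classical in
/-- The total area of those triangles of the mesh after `j` steps that have the property `P`. -/
noncomputable def areaOf (e : Triangle → Fin 3) (T : Triangle) (j : ℕ) (P : Triangle → Prop) : ℝ :=
  (((mesh e T j).filter P).map area).sum

/-- The entry `w_j(c)` of the area distribution vector: the proportion of the area of the triangle
`0, 1, z` that is occupied, after `j` steps, by triangles of the similarity class `c`. -/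
noncomputable def areaShare (e : Triangle → Fin 3) (z : ℂ) (j : ℕ) (c : ℂ) : ℝ :=
  areaOf e ![0, 1, z] j (fun T => HasShape T c) / area ![0, 1, z]

/-- The area of the triangle `0, 1, z` that is occupied, after `j` steps, by triangles that do not
belong to terminal quadruples. -/
noncomputable def nonterminalArea (e : Triangle → Fin 3) (z : ℂ) (j : ℕ) : ℝ :=
  areaOf e ![0, 1, z] j (fun T => ¬ ∃ c ∈ terminalClasses z, HasShape T c)

end LongestEdgeBisection

/-!
Bisection acts on similarity classes. `HasShape.unique` and `exists_hasShape` make `D` a set of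
representatives, and `HasShape.bisect` shows that the median to any longest edge of a triangle of
class `w` produces one half of class `L(w)` and one of class `R(w)`: if the longest edge is not
unique, a reflection of the triangle exchanges the candidates. Both halves have half of the area.
Hence the share of the area that belongs, after `j` steps, to a set `X` of classes is
`(avg ^ j) 1_X z`, where `avg f = (f ∘ L + f ∘ R) / 2` (`areaOf_eq_avg_pow`), and the theorem becomes
one about a finite Markov chain.

*Orbits.* Let `V = cut w` be the class of the triangle whose sides are half the two shorter sides of
`0, 1, w` and its median. The halves of `R(w)` always have the classes `w, V`. If the median has
length at least `1/2`, the halves of `V` have the classes `L(w), R(w)`; if `[0, w]` is the longest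
edge of the left half, the halves of `L(w)` have the classes `V, w`. So a point of region `I` has
the orbit `{w, L(w), R(w), V}`. In every other case the orbit of `w` consists of a few of these
classes and the orbits of `L(w)` or `V`. The point is that the latter either are settled already or
have imaginary part at least `Im w + (Im w) ^ 3` (`left_of_long_median`, `im_left_of_short_side`,
`cut_of_short_median`). Since `Im` is bounded on `D`, induction shows that every orbit is finite and
meets the terminal region (`terminates`).

*Limits.* Every class of the orbit thus has a terminal descendant, so the nonterminal mass decays
exponentially (`exists_geometric_bound`). On a terminal quadruple `avg` exchanges the pairs
`{w, V}` and `{L(w), R(w)}` and averages over each, whence `avg ^ 4 = avg ^ 2` there, whatever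
coincidences occur among the four classes. Therefore successive differences of `(avg ^ (2 j + s)) f z`
are bounded by the nonterminal mass, and the sequence converges. A terminal class `c` keeps at
least half of its mass after any even number of steps, which makes the limit positive as soon as
one term of the sequence is (`exists_limit_avg_pow`).
-/

/-! ### Similarity classes and their representatives in the normalized region -/

namespace LongestEdgeBisection

open Complex (normSq)

theorem normSq_sub_comm (p q : ℂ) : normSq (p - q) = normSq (q - p) := by
  rw [← neg_sub, Complex.normSq_neg]

theorem dist_sq_eq_normSq (p q : ℂ) : dist p q ^ 2 = normSq (p - q) := by
  rw [dist_eq_norm, Complex.sq_norm]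

theorem dist_le_dist_iff_normSq (p q r s : ℂ) :
    dist p q ≤ dist r s ↔ normSq (p - q) ≤ normSq (r - s) := by
  rw [← dist_sq_eq_normSq, ← dist_sq_eq_normSq]
  exact (pow_le_pow_iff_left₀ dist_nonneg dist_nonneg two_ne_zero).symm

theorem normSq_sub_midpoint (p q r : ℂ) : normSq (p - midpoint ℝ q r) =
    (2 * normSq (p - q) + 2 * normSq (p - r) - normSq (q - r)) / 4 := by
  rw [midpoint_eq_smul_add]
  simp [Complex.normSq_apply]
  ring

theorem normSq_left_sub_midpoint (q r : ℂ) :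
    normSq (q - midpoint ℝ q r) = normSq (q - r) / 4 := by
  rw [normSq_sub_midpoint]; simp; ring

theorem similar_of_normSq {p q r p' q' r' : ℂ} (k : ℝ) (hk : 0 < k)
    (hpq : normSq (p - q) = k * normSq (p' - q')) (hpr : normSq (p - r) = k * normSq (p' - r'))
    (hqr : normSq (q - r) = k * normSq (q' - r')) : Similar ![p, q, r] ![p', q', r'] := by
  have key : ∀ a b a' b' : ℂ, normSq (a - b) = k * normSq (a' - b') →
      dist a b = √k * dist a' b' := by
    intro a b a' b' h
    rw [← sq_eq_sq₀ dist_nonneg (by positivity), mul_pow, Real.sq_sqrt hk.le, dist_sq_eq_normSq,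
      dist_sq_eq_normSq, h]
  refine similar_iff_exists_pos_dist_eq.2 ⟨√k, by positivity, fun i j => ?_⟩
  fin_cases i <;> fin_cases j <;> apply key <;> simp [*] <;>
    rw [normSq_sub_comm, ‹normSq _ = _›, normSq_sub_comm]

theorem Similar.exists_normSq {ι : Type*} {T T' : ι → ℂ} (h : Similar T T') :
    ∃ k : ℝ, 0 < k ∧ ∀ i j, normSq (T i - T j) = k * normSq (T' i - T' j) := by
  obtain ⟨r, hr, h⟩ := similar_iff_exists_pos_dist_eq.1 h
  refine ⟨r ^ 2, by positivity, fun i j => ?_⟩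
  rw [← dist_sq_eq_normSq, h, mul_pow, dist_sq_eq_normSq]

theorem perm_fin_three_cases (σ : Equiv.Perm (Fin 3)) :
    (σ 0 = 0 ∧ σ 1 = 1 ∧ σ 2 = 2) ∨ (σ 0 = 0 ∧ σ 1 = 2 ∧ σ 2 = 1) ∨
    (σ 0 = 1 ∧ σ 1 = 0 ∧ σ 2 = 2) ∨ (σ 0 = 1 ∧ σ 1 = 2 ∧ σ 2 = 0) ∨
    (σ 0 = 2 ∧ σ 1 = 0 ∧ σ 2 = 1) ∨ (σ 0 = 2 ∧ σ 1 = 1 ∧ σ 2 = 0) := by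
  revert σ; decide

theorem mem_normalizedRegion_iff {w : ℂ} : w ∈ normalizedRegion ↔
    w.re ≤ 1 / 2 ∧ 0 < w.im ∧ (w.re - 1) ^ 2 + w.im ^ 2 ≤ 1 := by
  have h : ‖w - 1‖ ≤ 1 ↔ (w.re - 1) ^ 2 + w.im ^ 2 ≤ 1 := by
    rw [← sq_le_one_iff₀ (norm_nonneg _), Complex.sq_norm, Complex.normSq_apply]
    simp [sq]
  simp only [normalizedRegion, Set.mem_ofPred, h]

theorem half_le_norm_sub_half_iff {w : ℂ} :
    1 / 2 ≤ ‖w - 1 / 2‖ ↔ w.re ≤ w.re ^ 2 + w.im ^ 2 := by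
  rw [← sq_le_sq₀ (by norm_num) (norm_nonneg _), Complex.sq_norm, Complex.normSq_apply]
  norm_num
  constructor <;> intro h <;> nlinarith

theorem hasShape_perm {T : Triangle} (σ : Equiv.Perm (Fin 3)) {w : ℂ} :
    HasShape (T ∘ σ) w ↔ HasShape T w := by
  refine and_congr_right fun _ => ⟨fun ⟨τ, h⟩ => ⟨τ.trans σ, h⟩, fun ⟨τ, h⟩ => ⟨τ.trans σ.symm, ?_⟩⟩
  convert h using 1
  ext i; simp

theorem hasShape_congr {T T' : Triangle} (h : Similar T T') {w : ℂ} :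
    HasShape T w ↔ HasShape T' w := by
  refine and_congr_right fun _ => exists_congr fun τ => ?_
  have h' := h.index_map τ
  exact ⟨fun h1 => h'.symm.trans h1, fun h1 => h'.trans h1⟩

/-- Normalized triangles that are similar up to relabelling coincide: `D` contains one point of
each similarity class. -/
theorem HasShape.unique {T : Triangle} {w w' : ℂ} (h : HasShape T w) (h' : HasShape T w') :
    w = w' := by
  obtain ⟨hw', σ, hσ⟩ := h'
  rw [← hasShape_perm σ, hasShape_congr hσ] at h
  obtain ⟨hw, τ, hτ⟩ := h
  obtain ⟨k, hk, hd⟩ := Similar.exists_normSq hτ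
  rw [mem_normalizedRegion_iff] at hw hw'
  have h01 := hd 0 1
  have h02 := hd 0 2
  have h12 := hd 1 2
  suffices hk1 : k = 1 ∧ w.re ^ 2 + w.im ^ 2 = w'.re ^ 2 + w'.im ^ 2 ∧
      (w.re - 1) ^ 2 + w.im ^ 2 = (w'.re - 1) ^ 2 + w'.im ^ 2 by
    obtain ⟨-, h1, h2⟩ := hk1
    have hre : w.re = w'.re := by linarith
    refine Complex.ext hre ?_
    rw [hre] at h1
    have : w.im ^ 2 = w'.im ^ 2 := by linarith
    exact (pow_left_inj₀ hw.2.1.le hw'.2.1.le two_ne_zero).1 this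
  -- Both triples of squared sides are sorted, so a permutation matches them entry by entry.
  have ha : k * (w.re ^ 2 + w.im ^ 2) ≤ k * ((w.re - 1) ^ 2 + w.im ^ 2) :=
    mul_le_mul_of_nonneg_left (by nlinarith) hk.le
  have hb : k * ((w.re - 1) ^ 2 + w.im ^ 2) ≤ k := by nlinarith
  have ha' : w'.re ^ 2 + w'.im ^ 2 ≤ (w'.re - 1) ^ 2 + w'.im ^ 2 := by nlinarith
  suffices hs : k = 1 ∧ k * (w.re ^ 2 + w.im ^ 2) = w'.re ^ 2 + w'.im ^ 2 ∧
      k * ((w.re - 1) ^ 2 + w.im ^ 2) = (w'.re - 1) ^ 2 + w'.im ^ 2 by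
    obtain ⟨h1, h2⟩ := hs
    subst h1
    simpa using h2
  set A := k * (w.re ^ 2 + w.im ^ 2) with hA
  set B := k * ((w.re - 1) ^ 2 + w.im ^ 2) with hB
  have e02 : k * normSq (![0, 1, w] 0 - ![0, 1, w] 2) = A := by
    rw [hA]; congr 1; simp [Complex.normSq_apply]; ring
  have e12 : k * normSq (![0, 1, w] 1 - ![0, 1, w] 2) = B := by
    rw [hB]; congr 1; simp [Complex.normSq_apply]; ring
  have e01 : k * normSq (![0, 1, w] 0 - ![0, 1, w] 1) = k := by simp
  rw [e01] at h01
  rw [e02] at h02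
  rw [e12] at h12
  have f02 : normSq (0 - w') = w'.re ^ 2 + w'.im ^ 2 := by
    simp [Complex.normSq_apply]; ring
  have f12 : normSq (1 - w') = (w'.re - 1) ^ 2 + w'.im ^ 2 := by
    simp [Complex.normSq_apply]; ring
  have f01 : normSq ((0 : ℂ) - 1) = 1 := by simp
  have f20 : normSq (w' - 0) = w'.re ^ 2 + w'.im ^ 2 := by rw [normSq_sub_comm, f02]
  have f21 : normSq (w' - 1) = (w'.re - 1) ^ 2 + w'.im ^ 2 := by rw [normSq_sub_comm, f12]
  have f10 : normSq ((1 : ℂ) - 0) = 1 := by simp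
  generalize w'.re ^ 2 + w'.im ^ 2 = a at *
  generalize (w'.re - 1) ^ 2 + w'.im ^ 2 = b at *
  obtain ⟨s0, s1, s2⟩ | ⟨s0, s1, s2⟩ | ⟨s0, s1, s2⟩ | ⟨s0, s1, s2⟩ | ⟨s0, s1, s2⟩ | ⟨s0, s1, s2⟩ :=
    perm_fin_three_cases τ <;>
  simp only [Function.comp_apply, s0, s1, s2, Matrix.cons_val_zero, Matrix.cons_val_one,
    Matrix.cons_val, f01, f02, f12, f10, f20, f21] at h01 h02 h12 <;>
  refine ⟨?_, ?_, ?_⟩ <;> linarith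

/-- Twice the signed area of a triangle. -/
noncomputable def signedDet (T : Triangle) : ℝ :=
  (T 1 - T 0).re * (T 2 - T 0).im - (T 1 - T 0).im * (T 2 - T 0).re

theorem signedDet_perm_ne_zero {T : Triangle} (h : signedDet T ≠ 0) (σ : Equiv.Perm (Fin 3)) :
    signedDet (T ∘ σ) ≠ 0 := by
  have : signedDet (T ∘ σ) = signedDet T ∨ signedDet (T ∘ σ) = - signedDet T := by
    obtain ⟨s0, s1, s2⟩ | ⟨s0, s1, s2⟩ | ⟨s0, s1, s2⟩ | ⟨s0, s1, s2⟩ | ⟨s0, s1, s2⟩ | ⟨s0, s1, s2⟩ :=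
      perm_fin_three_cases σ <;>
    simp only [signedDet, Function.comp_apply, s0, s1, s2, Complex.sub_re, Complex.sub_im]
    · left; trivial
    · right; ring
    · right; ring
    · left; ring
    · left; ring
    · right; ring
  obtain h' | h' := this <;> simpa [h'] using h

theorem exists_perm_sorted (T : Triangle) : ∃ σ : Equiv.Perm (Fin 3),
    normSq (T (σ 1) - T (σ 2)) ≤ normSq (T (σ 0) - T (σ 1)) ∧
    normSq (T (σ 0) - T (σ 2)) ≤ normSq (T (σ 1) - T (σ 2)) := by
  let f : Fin 3 → ℝ := fun i => normSq (T (i + 1) - T (i + 2))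
  have hm := Tuple.monotone_sort f
  have h01 : f (Tuple.sort f 0) ≤ f (Tuple.sort f 1) := hm (by decide)
  have h12 : f (Tuple.sort f 1) ≤ f (Tuple.sort f 2) := hm (by decide)
  generalize Tuple.sort f = τ at *
  -- The vertex opposite to the shortest side becomes vertex `1`, the one opposite to the longest
  -- side becomes vertex `2`.
  refine ⟨(Equiv.swap 0 1).trans τ, ?_⟩
  have c : ∀ i j, normSq (T i - T j) = normSq (T j - T i) := fun i j => normSq_sub_comm _ _
  have e2 : Equiv.swap (0 : Fin 3) 1 2 = 2 := by decide
  obtain ⟨s0, s1, s2⟩ | ⟨s0, s1, s2⟩ | ⟨s0, s1, s2⟩ | ⟨s0, s1, s2⟩ | ⟨s0, s1, s2⟩ | ⟨s0, s1, s2⟩ :=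
    perm_fin_three_cases τ
  all_goals
    simp only [f, s0, s1, s2, Fin.isValue, zero_add, show (1 + 1 : Fin 3) = 2 from rfl,
      show (1 + 2 : Fin 3) = 0 from rfl, show (2 + 1 : Fin 3) = 0 from rfl,
      show (2 + 2 : Fin 3) = 1 from rfl] at h01 h12
    simp only [Equiv.trans_apply, Equiv.swap_apply_left, Equiv.swap_apply_right, e2, s0, s1, s2]
    constructor <;> linarith [c 0 1, c 0 2, c 1 2]

theorem exists_hasShape {T : Triangle} (hT : signedDet T ≠ 0) : ∃ w, HasShape T w := by
  obtain ⟨σ, h1, h2⟩ := exists_perm_sorted T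
  have hd := signedDet_perm_ne_zero hT σ
  suffices h : ∃ w, HasShape (T ∘ σ) w by simpa only [hasShape_perm] using h
  have hS : T ∘ σ = ![T (σ 0), T (σ 1), T (σ 2)] := by ext i; fin_cases i <;> rfl
  rw [hS] at hd ⊢
  generalize T (σ 0) = p at *
  generalize T (σ 1) = q at *
  generalize T (σ 2) = r at *
  have hpq : q - p ≠ 0 := by
    intro h0
    apply hd
    simp [signedDet] at h0 ⊢
    simp [sub_eq_zero.1 h0]
  have hn : 0 < normSq (q - p) := Complex.normSq_pos.2 hpq
  obtain ⟨u, hu⟩ : ∃ u, r - p = u * (q - p) := ⟨(r - p) / (q - p), by field_simp⟩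
  have hq1 : r - q = (u - 1) * (q - p) := by linear_combination hu
  have him : u.im ≠ 0 := by
    intro h0
    apply hd
    have : signedDet ![p, q, r] = (r - p).im * (q - p).re - (r - p).re * (q - p).im := by
      simp [signedDet]; ring
    rw [this, hu]
    simp [h0]; ring
  -- A reflection moves the third vertex to the upper half plane.
  let w : ℂ := ⟨u.re, |u.im|⟩
  have e1 : normSq w = normSq u := by simp [w, Complex.normSq_apply]
  have e2 : normSq (w - 1) = normSq (u - 1) := by simp [w, Complex.normSq_apply]
  have n1 : normSq (p - r) = normSq (q - p) * normSq (0 - w) := by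
    rw [normSq_sub_comm p, hu, Complex.normSq_mul, zero_sub, Complex.normSq_neg, e1, mul_comm]
  have n2 : normSq (q - r) = normSq (q - p) * normSq (1 - w) := by
    rw [normSq_sub_comm q r, hq1, Complex.normSq_mul, normSq_sub_comm 1, e2, mul_comm]
  rw [normSq_sub_comm p q, n2, mul_le_iff_le_one_right hn] at h1
  rw [n1, n2, mul_le_mul_iff_right₀ hn] at h2
  refine ⟨w, mem_normalizedRegion_iff.2 ⟨?_, abs_pos.2 him, ?_⟩, 1, ?_⟩
  · simp [Complex.normSq_apply] at h2; nlinarith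
  · simp [Complex.normSq_apply] at h1; nlinarith
  · refine similar_of_normSq _ hn ?_ n1 n2
    rw [normSq_sub_comm]; simp

theorem signedDet_ne_zero_of_im {w : ℂ} (hw : w.im ≠ 0) : signedDet ![0, 1, w] ≠ 0 := by
  simpa [signedDet] using hw

/-- The point of `D` that represents the similarity class of the triangle `T`. The value at a
degenerate triangle is arbitrary. -/
noncomputable def shape (T : Triangle) : ℂ := Classical.epsilon (HasShape T)

theorem hasShape_shape {T : Triangle} (hT : signedDet T ≠ 0) : HasShape T (shape T) :=
  Classical.epsilon_spec (exists_hasShape hT)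

theorem HasShape.shape_eq {T : Triangle} {w : ℂ} (h : HasShape T w) : shape T = w :=
  HasShape.unique (Classical.epsilon_spec ⟨w, h⟩) h

/-- The map `L` on similarity classes. -/
noncomputable def left (w : ℂ) : ℂ := shape (leftHalf w)

/-- The map `R` on similarity classes. -/
noncomputable def right (w : ℂ) : ℂ := shape (rightHalf w)

/-- The class of the triangle `1/2, w/2, w`, which is cut off from `0, 1/2, w` by the median
from `1/2`. Its sides are half the two shorter sides of `0, 1, w` and the median of `0, 1, w`. -/
noncomputable def cut (w : ℂ) : ℂ := shape ![1 / 2, w / 2, w]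

variable {w : ℂ}

theorem hasShape_left (hw : w ∈ normalizedRegion) : HasShape (leftHalf w) (left w) :=
  hasShape_shape (by simpa [signedDet, leftHalf] using hw.2.1.ne')

theorem hasShape_right (hw : w ∈ normalizedRegion) : HasShape (rightHalf w) (right w) := by
  refine hasShape_shape ?_
  have := hw.2.1
  norm_num [signedDet, rightHalf]
  exact this.ne'

theorem hasShape_cut (hw : w ∈ normalizedRegion) : HasShape ![1 / 2, w / 2, w] (cut w) := by
  refine hasShape_shape ?_
  have := hw.2.1
  have h : signedDet ![1 / 2, w / 2, w] = - (w.im / 4) := by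
    simp [signedDet]; norm_num; ring
  rw [h]
  exact neg_ne_zero.2 (by positivity)

theorem left_mem (hw : w ∈ normalizedRegion) : left w ∈ normalizedRegion := (hasShape_left hw).1

theorem cut_mem (hw : w ∈ normalizedRegion) : cut w ∈ normalizedRegion := (hasShape_cut hw).1

theorem hasShape_self (hw : w ∈ normalizedRegion) : HasShape ![0, 1, w] w :=
  ⟨hw, 1, Similar.refl _⟩

end LongestEdgeBisection

/-! ### Bisection of a triangle and the classes of its halves -/

namespace LongestEdgeBisection

open Complex (normSq)

theorem isLongestEdge_iff {T : Triangle} {i : Fin 3} : IsLongestEdge T i ↔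
    ∀ k, normSq (T (k + 1) - T (k + 2)) ≤ normSq (T (i + 1) - T (i + 2)) :=
  forall_congr' fun _ => dist_le_dist_iff_normSq _ _ _ _

theorem hasShape_comm_right {p q r w : ℂ} : HasShape ![p, q, r] w ↔ HasShape ![p, r, q] w := by
  rw [← hasShape_perm (Equiv.swap 1 2)]
  have : ![p, q, r] ∘ Equiv.swap (1 : Fin 3) 2 = ![p, r, q] := by
    ext i; fin_cases i <;> simp [Equiv.swap_apply_of_ne_of_ne]
  rw [this]

theorem hasShape_comm_left {p q r w : ℂ} : HasShape ![p, q, r] w ↔ HasShape ![q, p, r] w := by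
  rw [← hasShape_perm (Equiv.swap 0 1)]
  have : ![p, q, r] ∘ Equiv.swap (0 : Fin 3) 1 = ![q, p, r] := by
    ext i; fin_cases i <;> simp [Equiv.swap_apply_of_ne_of_ne]
  rw [this]

theorem hasShape_half_congr {p q r p' q' r' w : ℂ} (k : ℝ) (hk : 0 < k)
    (hpq : normSq (p - q) = k * normSq (p' - q')) (hpr : normSq (p - r) = k * normSq (p' - r'))
    (hqr : normSq (q - r) = k * normSq (q' - r')) :
    HasShape ![p, q, midpoint ℝ q r] w ↔ HasShape ![p', q', midpoint ℝ q' r'] w := by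
  refine hasShape_congr (similar_of_normSq k hk hpq ?_ ?_)
  · rw [normSq_sub_midpoint, normSq_sub_midpoint, hpq, hpr, hqr]; ring
  · rw [normSq_left_sub_midpoint, normSq_left_sub_midpoint, hqr]; ring

theorem HasShape.half_left {p q r u : ℂ} (hu : u ∈ normalizedRegion) (k : ℝ) (hk : 0 < k)
    (hpq : normSq (p - q) = k * normSq u) (hpr : normSq (p - r) = k * normSq (u - 1))
    (hqr : normSq (q - r) = k) : HasShape ![p, q, midpoint ℝ q r] (left u) := by
  rw [hasShape_half_congr (p' := u) (q' := 0) (r' := 1) k hk (by simpa using hpq) hpr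
    (by simpa using hqr), hasShape_comm_right, hasShape_comm_left, hasShape_comm_right,
    hasShape_comm_left]
  have : midpoint ℝ (0 : ℂ) 1 = 1 / 2 := by rw [midpoint_eq_smul_add]; simp
  rw [this]
  exact hasShape_left hu

theorem HasShape.half_right {p q r u : ℂ} (hu : u ∈ normalizedRegion) (k : ℝ) (hk : 0 < k)
    (hpq : normSq (p - q) = k * normSq (u - 1)) (hpr : normSq (p - r) = k * normSq u)
    (hqr : normSq (q - r) = k) : HasShape ![p, q, midpoint ℝ q r] (right u) := by
  rw [hasShape_half_congr (p' := u) (q' := 1) (r' := 0) k hk hpq (by simpa using hpr)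
    (by simpa using hqr), hasShape_comm_left, hasShape_comm_right, hasShape_comm_left]
  have : midpoint ℝ (1 : ℂ) 0 = 1 / 2 := by rw [midpoint_eq_smul_add]; simp
  rw [this]
  exact hasShape_right hu

/-- Whichever longest edge is chosen, bisecting a triangle of class `u` yields one triangle of
class `L(u)` and one of class `R(u)`. If the longest edge is not unique, the triangle has a
reflection that exchanges the candidates. -/
theorem HasShape.bisect {T : Triangle} {u : ℂ} {i : Fin 3} (h : HasShape T u)
    (hi : IsLongestEdge T i) :
    ∃ A B, bisect T i = {A, B} ∧ HasShape A (left u) ∧ HasShape B (right u) := by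
  obtain ⟨hu, σ, hσ⟩ := h
  obtain ⟨k, hk, hd⟩ := Similar.exists_normSq hσ
  rw [isLongestEdge_iff] at hi
  have hu' := mem_normalizedRegion_iff.1 hu
  have hb : k * normSq (u - 1) ≤ k := by
    rw [mul_le_iff_le_one_right hk]
    simp [Complex.normSq_apply]; nlinarith
  have ha : k * normSq u ≤ k * normSq (u - 1) := by
    refine mul_le_mul_of_nonneg_left ?_ hk.le
    simp [Complex.normSq_apply]; nlinarith
  have hd01 := hd 0 1
  have hd02 := hd 0 2
  have hd12 := hd 1 2
  have key : normSq (T (i + 1) - T (i + 2)) = k ∧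
      ((normSq (T i - T (i + 1)) = k * normSq u ∧
        normSq (T i - T (i + 2)) = k * normSq (u - 1)) ∨
      (normSq (T i - T (i + 1)) = k * normSq (u - 1) ∧
        normSq (T i - T (i + 2)) = k * normSq u)) := by
    have c : ∀ i j, normSq (T i - T j) = normSq (T j - T i) := fun i j => normSq_sub_comm _ _
    have c01 := c 0 1
    have c02 := c 0 2
    have c12 := c 1 2
    have i0 := hi 0
    have i1 := hi 1
    have i2 := hi 2
    have e11 : (1 + 1 : Fin 3) = 2 := rfl
    have e12 : (1 + 2 : Fin 3) = 0 := rfl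
    have e21 : (2 + 1 : Fin 3) = 0 := rfl
    have e22 : (2 + 2 : Fin 3) = 1 := rfl
    have n1 : normSq (1 - u) = normSq (u - 1) := normSq_sub_comm _ _
    obtain ⟨s0, s1, s2⟩ | ⟨s0, s1, s2⟩ | ⟨s0, s1, s2⟩ | ⟨s0, s1, s2⟩ | ⟨s0, s1, s2⟩ |
      ⟨s0, s1, s2⟩ := perm_fin_three_cases σ <;>
    simp only [Function.comp_apply, s0, s1, s2, Matrix.cons_val_zero, Matrix.cons_val_one,
      Matrix.cons_val, zero_sub, Complex.normSq_neg, map_one, mul_one, n1] at hd01 hd02 hd12 <;>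
    clear hd hσ s0 s1 s2 hi c hu hu' <;>
    fin_cases i <;>
    simp only [Fin.mk_zero, Fin.mk_one, Fin.reduceFinMk, zero_add, e11, e12, e21,
      e22] at i0 i1 i2 ⊢ <;>
    first
      | exact ⟨by linarith, Or.inl ⟨by linarith, by linarith⟩⟩
      | exact ⟨by linarith, Or.inr ⟨by linarith, by linarith⟩⟩
  obtain ⟨h1, ⟨h2, h3⟩ | ⟨h2, h3⟩⟩ := key
  · refine ⟨_, _, rfl, HasShape.half_left hu k hk h2 h3 h1, ?_⟩
    rw [hasShape_comm_right, midpoint_comm]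
    exact HasShape.half_right hu k hk h3 h2 (by rw [normSq_sub_comm, h1])
  · refine ⟨_, _, Multiset.pair_comm _ _, ?_, HasShape.half_right hu k hk h2 h3 h1⟩
    rw [hasShape_comm_right, midpoint_comm]
    exact HasShape.half_left hu k hk h3 h2 (by rw [normSq_sub_comm, h1])

/-- The classes of the children of `u`, read off from any triangle of class `u`. -/
theorem HasShape.children_eq {T A B : Triangle} {u a b : ℂ} {i : Fin 3} (h : HasShape T u)
    (hi : IsLongestEdge T i) (hAB : LongestEdgeBisection.bisect T i = {A, B}) (ha : HasShape A a)
    (hb : HasShape B b) : s(left u, right u) = s(a, b) := by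
  obtain ⟨A', B', h', hl, hr⟩ := h.bisect hi
  rw [h'] at hAB
  rw [Sym2.eq_iff]
  obtain ⟨rfl, h2⟩ | ⟨-, cs, h2, h3⟩ := Multiset.cons_eq_cons.1 hAB
  · left
    rw [Multiset.singleton_inj] at h2
    subst h2
    exact ⟨hl.unique ha, hr.unique hb⟩
  · right
    obtain ⟨rfl, rfl⟩ := (Multiset.singleton_eq_cons_iff ..).1 h2
    rw [Multiset.singleton_eq_cons_iff] at h3
    obtain ⟨rfl, -⟩ := h3
    exact ⟨hl.unique hb, hr.unique ha⟩

variable {w : ℂ}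

theorem re_pos (hw : w ∈ normalizedRegion) : 0 < w.re := by
  obtain ⟨h1, h2, h3⟩ := mem_normalizedRegion_iff.1 hw
  nlinarith [sq_pos_of_pos h2]

/-- The longest edge of the right half `1/2, 1, w` is `[1, w]`, and its median cuts off a smaller
copy of `0, 1, w`. -/
theorem children_right (hw : w ∈ normalizedRegion) :
    s(left (right w), right (right w)) = s(w, cut w) := by
  obtain ⟨h1, h2, h3⟩ := mem_normalizedRegion_iff.1 hw
  refine (hasShape_right hw).children_eq (i := 0) ?_ rfl ?_ ?_
  · rw [isLongestEdge_iff]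
    intro k
    fin_cases k <;> simp [rightHalf, Complex.normSq_apply] <;> nlinarith
  · refine (hasShape_congr (similar_of_normSq 4 (by norm_num) ?_ ?_ ?_)).1 (hasShape_self hw)
    all_goals simp [rightHalf, midpoint_eq_smul_add, Complex.normSq_apply]; ring_nf
  · rw [hasShape_comm_left, hasShape_comm_right, hasShape_comm_left]
    refine (hasShape_congr (similar_of_normSq 1 (by norm_num) ?_ ?_ ?_)).1 (hasShape_cut hw)
    all_goals simp [rightHalf, midpoint_eq_smul_add, Complex.normSq_apply]; ring_nf

/-- If `[0, w]` is the longest edge of the left half `0, 1/2, w`, then its median cuts off a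
smaller copy of `0, 1, w`. -/
theorem children_left (hw : w ∈ normalizedRegion) (hx : 1 / 4 ≤ w.re)
    (ha : 1 / 4 ≤ w.re ^ 2 + w.im ^ 2) : s(left (left w), right (left w)) = s(cut w, w) := by
  obtain ⟨h1, h2, h3⟩ := mem_normalizedRegion_iff.1 hw
  refine (hasShape_left hw).children_eq (i := 1) ?_ rfl ?_ ?_
  · rw [isLongestEdge_iff]
    intro k
    fin_cases k <;> simp [leftHalf, Complex.normSq_apply] <;> nlinarith
  · rw [hasShape_comm_right]
    refine (hasShape_congr (similar_of_normSq 1 (by norm_num) ?_ ?_ ?_)).1 (hasShape_cut hw)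
    all_goals simp [leftHalf, midpoint_eq_smul_add, Complex.normSq_apply] <;> ring_nf
  · rw [hasShape_comm_right, hasShape_comm_left]
    refine (hasShape_congr (similar_of_normSq 4 (by norm_num) ?_ ?_ ?_)).1 (hasShape_self hw)
    all_goals simp [leftHalf, midpoint_eq_smul_add, Complex.normSq_apply]; ring_nf

/-- If the median to `[0, 1]` has length at least `1/2`, then it is the longest edge of the
triangle `1/2, w/2, w`, whose halves are similar to those of `0, 1, w`. -/
theorem children_cut (hw : w ∈ normalizedRegion) (hm : w.re ≤ w.re ^ 2 + w.im ^ 2) :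
    s(left (cut w), right (cut w)) = s(left w, right w) := by
  obtain ⟨h1, h2, h3⟩ := mem_normalizedRegion_iff.1 hw
  refine (hasShape_cut hw).children_eq (i := 1) ?_ rfl ?_ ?_
  · rw [isLongestEdge_iff]
    intro k
    fin_cases k <;> simp [Complex.normSq_apply] <;> nlinarith
  · rw [hasShape_comm_right]
    refine (hasShape_congr (similar_of_normSq 4 (by norm_num) ?_ ?_ ?_)).1 (hasShape_left hw)
    all_goals simp [midpoint_eq_smul_add, Complex.normSq_apply]; ring_nf
  · rw [hasShape_comm_left]
    refine (hasShape_congr (similar_of_normSq 4 (by norm_num) ?_ ?_ ?_)).1 (hasShape_right hw)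
    all_goals simp [midpoint_eq_smul_add, Complex.normSq_apply]; ring_nf

end LongestEdgeBisection

/-! ### Finiteness of orbits -/

namespace LongestEdgeBisection

open Complex (normSq)
open ComplexConjugate

variable {w z u v : ℂ}

theorem mem_orbit_self (z : ℂ) : z ∈ orbit z := Relation.ReflTransGen.refl

theorem orbit_trans (h : u ∈ orbit z) (hv : v ∈ orbit u) : v ∈ orbit z :=
  Relation.ReflTransGen.trans h hv

theorem mem_normalizedRegion_of_mem_orbit (hz : z ∈ normalizedRegion) (h : u ∈ orbit z) :
    u ∈ normalizedRegion := by
  induction h with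
  | refl => exact hz
  | tail _ h _ => exact h.elim (·.1) (·.1)

theorem left_mem_orbit (hz : z ∈ normalizedRegion) (h : u ∈ orbit z) : left u ∈ orbit z :=
  h.tail (Or.inl (hasShape_left (mem_normalizedRegion_of_mem_orbit hz h)))

theorem right_mem_orbit (hz : z ∈ normalizedRegion) (h : u ∈ orbit z) : right u ∈ orbit z :=
  h.tail (Or.inr (hasShape_right (mem_normalizedRegion_of_mem_orbit hz h)))

theorem orbit_subset {S : Set ℂ} (hzS : z ∈ S) (hS : ∀ u ∈ S, left u ∈ S ∧ right u ∈ S) :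
    orbit z ⊆ S := by
  intro v hv
  induction hv with
  | refl => exact hzS
  | tail _ h ih =>
    obtain h | h := h
    · exact h.shape_eq ▸ (hS _ ih).1
    · exact h.shape_eq ▸ (hS _ ih).2

theorem children_mem_of_eq {S : Set ℂ} {a b : ℂ} (h : s(left u, right u) = s(a, b)) (ha : a ∈ S)
    (hb : b ∈ S) : left u ∈ S ∧ right u ∈ S := by
  obtain ⟨h1, h2⟩ | ⟨h1, h2⟩ := Sym2.eq_iff.1 h <;> rw [h1, h2] <;> constructor <;> assumption

theorem mem_regionI_iff : w ∈ regionI ↔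
    w ∈ normalizedRegion ∧ 1 / 4 ≤ w.re ∧ w.re ≤ w.re ^ 2 + w.im ^ 2 := by
  simp only [regionI, Set.mem_ofPred, half_le_norm_sub_half_iff]

/-- The orbit of a class `u` of region `I` consists of at most four classes. -/
theorem orbit_subset_of_mem_regionI (hu : u ∈ regionI) :
    orbit u ⊆ {u, left u, right u, cut u} := by
  obtain ⟨hD, hx, hm⟩ := mem_regionI_iff.1 hu
  refine orbit_subset (by simp) fun v hv => ?_
  obtain rfl | rfl | rfl | rfl := hv
  · simp
  · exact children_mem_of_eq (children_left hD hx (hx.trans hm)) (by simp) (by simp)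
  · exact children_mem_of_eq (children_right hD) (by simp) (by simp)
  · exact children_mem_of_eq (children_cut hD hm) (by simp) (by simp)

/-- The shape of a triangle similar to `0, 1, v` whose longest edge corresponds to `[0, 1]`. -/
theorem hasShape_or_of_similar {T : Triangle} (h : Similar T ![0, 1, v]) (him : 0 < v.im)
    (h0 : v.re ^ 2 + v.im ^ 2 ≤ 1) (h1 : (v.re - 1) ^ 2 + v.im ^ 2 ≤ 1) :
    (v.re ≤ 1 / 2 ∧ HasShape T v) ∨ (1 / 2 ≤ v.re ∧ HasShape T (1 - conj v)) := by
  obtain hv | hv := le_total v.re (1 / 2)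
  · exact Or.inl ⟨hv, (hasShape_congr h).2 (hasShape_self (mem_normalizedRegion_iff.2 ⟨hv, him, h1⟩))⟩
  · refine Or.inr ⟨hv, (hasShape_congr h).2 ?_⟩
    rw [hasShape_comm_left]
    refine (hasShape_congr (similar_of_normSq 1 one_pos ?_ ?_ ?_)).2
      (hasShape_self (mem_normalizedRegion_iff.2 ⟨?_, ?_, ?_⟩))
    all_goals simp [Complex.normSq_apply]
    · linarith
    · linarith
    · exact him
    · linarith

/-- If the median to `[0, 1]` is at least `1/2` and `Re w ≤ 1/4`, then this median is the longest
edge of the left half. Its class again has a long median, and either it lies in region `I` or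
its imaginary part is larger than that of `w` by a definite amount. -/
theorem left_of_long_median (hw : w ∈ normalizedRegion) (hx : w.re ≤ 1 / 4)
    (hm : w.re ≤ w.re ^ 2 + w.im ^ 2) :
    left w ∈ regionI ∨ ((left w).re ≤ (left w).re ^ 2 + (left w).im ^ 2 ∧
      w.im + w.im ^ 3 ≤ (left w).im) := by
  have hx0 := re_pos hw
  have hL := hasShape_left hw
  obtain ⟨h1, h2, h3⟩ := mem_normalizedRegion_iff.1 hw
  obtain ⟨M, hM⟩ : ∃ M, M = (2 * w.re - 1) ^ 2 + 4 * w.im ^ 2 := ⟨_, rfl⟩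
  have hM0 : 0 < M := by rw [hM]; positivity
  obtain ⟨v, hv⟩ : ∃ v : ℂ, v = ⟨(1 - 2 * w.re) / M, 2 * w.im / M⟩ := ⟨_, rfl⟩
  have hre : v.re = (1 - 2 * w.re) / M := by rw [hv]
  have him : v.im = 2 * w.im / M := by rw [hv]
  have n0 : v.re ^ 2 + v.im ^ 2 = 1 / M := by
    rw [hre, him]; field_simp; rw [hM]; ring
  have n1 : (v.re - 1) ^ 2 + v.im ^ 2 = 4 * (w.re ^ 2 + w.im ^ 2) / M := by
    have : (v.re - 1) ^ 2 + v.im ^ 2 = 1 / M - 2 * ((1 - 2 * w.re) / M) + 1 := by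
      rw [← n0, ← hre]; ring
    rw [this]; field_simp; rw [hM]; ring
  have hs : Similar ![1 / 2, w, 0] ![0, 1, v] := by
    refine similar_of_normSq (M / 4) (by positivity) ?_ ?_ ?_
    · simp [Complex.normSq_apply, hM]; ring
    · rw [zero_sub, Complex.normSq_neg, Complex.normSq_apply v, ← sq, ← sq, n0]
      field_simp; norm_num
    · rw [normSq_sub_comm 1, sub_zero, Complex.normSq_apply w, Complex.normSq_apply, ← sq, ← sq,
        ← sq, ← sq, Complex.sub_re, Complex.sub_im, Complex.one_re, Complex.one_im, sub_zero, n1]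
      field_simp
  have hvpos : 0 < v.im := by rw [him]; positivity
  have hM1 : 1 ≤ M := by rw [hM]; nlinarith
  have hLs : HasShape ![1 / 2, w, 0] (left w) := by
    rw [hasShape_comm_right, hasShape_comm_left]; exact hL
  have hacute : v.re ≤ v.re ^ 2 + v.im ^ 2 := by
    rw [n0, hre]
    gcongr
    linarith
  obtain ⟨hv2, hsh⟩ | ⟨hv2, hsh⟩ := hasShape_or_of_similar hs hvpos
    (by rw [n0, div_le_one hM0]; exact hM1) (by rw [n1, div_le_one hM0, hM]; nlinarith)
  · left
    rw [hLs.unique hsh, mem_regionI_iff]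
    refine ⟨hsh.1, ?_, hacute⟩
    rw [hre, div_le_div_iff₀ (by norm_num) hM0, hM]
    nlinarith
  · right
    rw [hLs.unique hsh]
    simp only [Complex.sub_re, Complex.one_re, Complex.conj_re, Complex.sub_im, Complex.one_im,
      Complex.conj_im, zero_sub, neg_neg]
    refine ⟨by nlinarith, ?_⟩
    rw [hre, div_le_div_iff₀ (by norm_num) hM0] at hv2
    rw [him, le_div_iff₀ hM0]
    have hM2 : M ≤ 2 * (1 - w.im ^ 2) := by nlinarith
    calc (w.im + w.im ^ 3) * M ≤ (w.im + w.im ^ 3) * (2 * (1 - w.im ^ 2)) := by gcongr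
      _ = 2 * w.im - 2 * w.im ^ 5 := by ring
      _ ≤ 2 * w.im := by have := pow_pos h2 5; linarith

/-- If the median to `[0, 1]` is at most `1/2` and `[0, 1/2]` is the longest edge of the left
half, then the imaginary part doubles. -/
theorem im_left_of_short_side (hw : w ∈ normalizedRegion)
    (hm : w.re ^ 2 + w.im ^ 2 ≤ w.re) (ha : w.re ^ 2 + w.im ^ 2 ≤ 1 / 4) :
    w.im + w.im ^ 3 ≤ (left w).im := by
  have hL := hasShape_left hw
  obtain ⟨h1, h2, h3⟩ := mem_normalizedRegion_iff.1 hw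
  have hs : Similar (leftHalf w) ![0, 1, 2 * w] := by
    refine similar_of_normSq (1 / 4) (by norm_num) ?_ ?_ ?_
    all_goals simp [Complex.normSq_apply]; ring_nf
  have him : (left w).im = 2 * w.im := by
    obtain ⟨-, hsh⟩ | ⟨-, hsh⟩ := hasShape_or_of_similar hs (by simpa using h2)
      (by simp; nlinarith) (by simp; nlinarith) <;> rw [hL.unique hsh] <;> simp
  have : w.im ^ 2 ≤ 1 := by nlinarith
  rw [him]; nlinarith

/-- If the median to `[0, 1]` is at most `1/2`, then the class of `1/2, w/2, w` has a long
median, or its imaginary part is larger than that of `w` by a definite amount. -/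
theorem cut_of_short_median (hw : w ∈ normalizedRegion) (hm : w.re ^ 2 + w.im ^ 2 ≤ w.re) :
    ((cut w).re ≤ (cut w).re ^ 2 + (cut w).im ^ 2 ∧ w.im ≤ (cut w).im) ∨
      w.im + w.im ^ 3 ≤ (cut w).im := by
  have hC := hasShape_cut hw
  obtain ⟨h1, h2, h3⟩ := mem_normalizedRegion_iff.1 hw
  obtain ⟨M, hM⟩ : ∃ M, M = (2 * w.re - 1) ^ 2 + 4 * w.im ^ 2 := ⟨_, rfl⟩
  have hM0 : 0 < M := by rw [hM]; positivity
  obtain ⟨B, hB⟩ : ∃ B, B = (1 - w.re) ^ 2 + w.im ^ 2 := ⟨_, rfl⟩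
  have hB0 : 0 < B := by rw [hB]; positivity
  obtain hBM | hBM := le_total B M
  · -- The longest edge is `[1/2, w]`.
    left
    obtain ⟨v, hv⟩ : ∃ v : ℂ, v = ⟨(2 * (w.re ^ 2 + w.im ^ 2) - w.re) / M, w.im / M⟩ := ⟨_, rfl⟩
    have hre : v.re = (2 * (w.re ^ 2 + w.im ^ 2) - w.re) / M := by rw [hv]
    have him : v.im = w.im / M := by rw [hv]
    have n0 : v.re ^ 2 + v.im ^ 2 = (w.re ^ 2 + w.im ^ 2) / M := by
      rw [hre, him]; field_simp; rw [hM]; ring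
    have n1 : (v.re - 1) ^ 2 + v.im ^ 2 = B / M := by
      have : (v.re - 1) ^ 2 + v.im ^ 2 = (w.re ^ 2 + w.im ^ 2) / M -
          2 * ((2 * (w.re ^ 2 + w.im ^ 2) - w.re) / M) + 1 := by
        rw [← n0, ← hre]; ring
      rw [this]; field_simp; rw [hM, hB]; ring
    have hs : Similar ![w, 1 / 2, w / 2] ![0, 1, v] := by
      refine similar_of_normSq (M / 4) (by positivity) ?_ ?_ ?_
      · simp [Complex.normSq_apply, hM]; ring
      · rw [zero_sub, Complex.normSq_neg, Complex.normSq_apply v, ← sq, ← sq, n0]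
        field_simp; simp [Complex.normSq_apply]; ring
      · rw [normSq_sub_comm 1, Complex.normSq_apply (v - 1), ← sq,
          ← sq, Complex.sub_re, Complex.sub_im, Complex.one_re, Complex.one_im, sub_zero, n1]
        field_simp; rw [hB]; simp [Complex.normSq_apply]; ring
    have hCs : HasShape ![w, 1 / 2, w / 2] (cut w) := by
      rw [hasShape_comm_left, hasShape_comm_right]; exact hC
    have hM1 : M ≤ 1 := by rw [hM]; nlinarith
    have hacute : v.re ≤ v.re ^ 2 + v.im ^ 2 := by
      rw [n0, hre]
      gcongr
      linarith
    have hgain : w.im ≤ v.im := by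
      rw [him, le_div_iff₀ hM0]; nlinarith
    obtain ⟨hv2, hsh⟩ | ⟨hv2, hsh⟩ := hasShape_or_of_similar hs (h2.trans_le hgain)
      (by rw [n0, div_le_one hM0]; rw [hB] at hBM; nlinarith) (by rw [n1, div_le_one hM0]; exact hBM)
    · rw [hCs.unique hsh]; exact ⟨hacute, hgain⟩
    · rw [hCs.unique hsh]
      simp only [Complex.sub_re, Complex.one_re, Complex.conj_re, Complex.sub_im, Complex.one_im,
        Complex.conj_im, zero_sub, neg_neg]
      exact ⟨by nlinarith, hgain⟩
  · -- The longest edge is `[1/2, w/2]`.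
    right
    obtain ⟨v, hv⟩ : ∃ v : ℂ, v = ⟨(w.re - (w.re ^ 2 + w.im ^ 2)) / B, w.im / B⟩ := ⟨_, rfl⟩
    have hre : v.re = (w.re - (w.re ^ 2 + w.im ^ 2)) / B := by rw [hv]
    have him : v.im = w.im / B := by rw [hv]
    have n0 : v.re ^ 2 + v.im ^ 2 = (w.re ^ 2 + w.im ^ 2) / B := by
      rw [hre, him]; field_simp; rw [hB]; ring
    have n1 : (v.re - 1) ^ 2 + v.im ^ 2 = M / B := by
      have : (v.re - 1) ^ 2 + v.im ^ 2 = (w.re ^ 2 + w.im ^ 2) / B -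
          2 * ((w.re - (w.re ^ 2 + w.im ^ 2)) / B) + 1 := by
        rw [← n0, ← hre]; ring
      rw [this]; field_simp; rw [hM, hB]; ring
    have hs : Similar ![w / 2, 1 / 2, w] ![0, 1, v] := by
      refine similar_of_normSq (B / 4) (by positivity) ?_ ?_ ?_
      · simp [Complex.normSq_apply, hB]; ring
      · rw [zero_sub, Complex.normSq_neg, Complex.normSq_apply v, ← sq, ← sq, n0]
        field_simp; simp [Complex.normSq_apply]; ring
      · rw [normSq_sub_comm 1, Complex.normSq_apply (v - 1), ← sq,
          ← sq, Complex.sub_re, Complex.sub_im, Complex.one_re, Complex.one_im, sub_zero, n1]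
        field_simp; rw [hM]; simp [Complex.normSq_apply]; ring
    have hCs : HasShape ![w / 2, 1 / 2, w] (cut w) := by
      rw [hasShape_comm_left]; exact hC
    have hB1 : B ≤ 1 - w.im ^ 2 := by rw [hB]; nlinarith
    have hgain : w.im + w.im ^ 3 ≤ v.im := by
      rw [him, le_div_iff₀ hB0]
      calc (w.im + w.im ^ 3) * B ≤ (w.im + w.im ^ 3) * (1 - w.im ^ 2) := by gcongr
        _ = w.im - w.im ^ 5 := by ring
        _ ≤ w.im := by have := pow_pos h2 5; linarith
    have hvpos : 0 < v.im := by rw [him]; positivity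
    obtain ⟨hv2, hsh⟩ | ⟨hv2, hsh⟩ := hasShape_or_of_similar hs hvpos
      (by rw [n0, div_le_one hB0, hB]; nlinarith) (by rw [n1, div_le_one hB0]; exact hBM)
    · rw [hCs.unique hsh]; exact hgain
    · rw [hCs.unique hsh]
      simpa using hgain

/-- Induction on the imaginary part: it is bounded on `D`, so it can grow by definite amounts
only finitely often. -/
theorem normalizedRegion_induction {P : ℂ → Prop}
    (h : ∀ w ∈ normalizedRegion,
      (∀ v ∈ normalizedRegion, w.im + w.im ^ 3 ≤ v.im → P v) → P w)
    (hw : w ∈ normalizedRegion) : P w := by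
  have him := hw.2.1
  suffices H : ∀ n : ℕ, ∀ v ∈ normalizedRegion, w.im ≤ v.im → 1 < v.im + n * w.im ^ 3 → P v by
    obtain ⟨n, hn⟩ := exists_nat_gt (1 / w.im ^ 3)
    refine H n w hw le_rfl ?_
    rw [div_lt_iff₀ (by positivity)] at hn
    linarith
  intro n
  induction n with
  | zero =>
    intro v hv _ h1
    obtain ⟨-, h2, h3⟩ := mem_normalizedRegion_iff.1 hv
    norm_num at h1
    nlinarith [sq_nonneg (v.re - 1)]
  | succ n ih =>
    intro v hv hwv h1
    refine h v hv fun t ht hvt => ih t ht ?_ ?_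
    · have := pow_pos (him.trans_le hwv) 3
      linarith
    · have : w.im ^ 3 ≤ v.im ^ 3 := by gcongr
      push_cast at h1
      linarith

/-- A class with a finite orbit that meets the terminal region. -/
def Terminates (w : ℂ) : Prop := (orbit w).Finite ∧ ∃ u ∈ orbit w, u ∈ terminalRegion

theorem Terminates.of_mem_regionI (hw : w ∈ regionI) : Terminates w :=
  ⟨(Set.toFinite _).subset (orbit_subset_of_mem_regionI hw), w, mem_orbit_self w, Or.inl hw⟩

theorem Terminates.of_long_median (hw : w ∈ normalizedRegion) :
    w.re ≤ w.re ^ 2 + w.im ^ 2 → Terminates w := by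
  refine normalizedRegion_induction (P := fun w => w.re ≤ w.re ^ 2 + w.im ^ 2 → Terminates w)
    (fun w hw ih hm => ?_) hw
  obtain hx | hx := le_total (1 / 4) w.re
  · exact .of_mem_regionI (mem_regionI_iff.2 ⟨hw, hx, hm⟩)
  have hL : Terminates (left w) := by
    obtain h | h := left_of_long_median hw hx hm
    · exact .of_mem_regionI h
    · exact ih _ (left_mem hw) h.2 h.1
  obtain ⟨hfin, u, hu, huA⟩ := hL
  refine ⟨?_, u, orbit_trans (left_mem_orbit hw (mem_orbit_self w)) hu, huA⟩
  refine ((Set.toFinite {w, right w, cut w}).union hfin).subset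
    (orbit_subset (by simp) fun v hv => ?_)
  have hLL := mem_orbit_self (left w)
  obtain (rfl | rfl | rfl) | hv := hv
  · simp [hLL]
  · exact children_mem_of_eq (children_right hw) (by simp) (by simp)
  · exact children_mem_of_eq (children_cut hw hm) (by simp [hLL]) (by simp)
  · exact ⟨Or.inr (left_mem_orbit (left_mem hw) hv), Or.inr (right_mem_orbit (left_mem hw) hv)⟩

theorem cut_mem_orbit (hw : w ∈ normalizedRegion) : cut w ∈ orbit w := by
  have hR := right_mem_orbit hw (mem_orbit_self w)
  obtain ⟨-, h⟩ | ⟨h, -⟩ := Sym2.eq_iff.1 (children_right hw)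
  · exact h ▸ right_mem_orbit hw hR
  · exact h ▸ left_mem_orbit hw hR

/-- Every class has a finite orbit, and this orbit meets the terminal region. -/
theorem terminates (hw : w ∈ normalizedRegion) : Terminates w := by
  refine normalizedRegion_induction (fun w hw ih => ?_) hw
  obtain hm | hm := le_total w.re (w.re ^ 2 + w.im ^ 2)
  · exact .of_long_median hw hm
  have hC : Terminates (cut w) := by
    obtain h | h := cut_of_short_median hw hm
    · exact .of_long_median (cut_mem hw) h.1
    · exact ih _ (cut_mem hw) h
  obtain ⟨hfin, u, hu, huA⟩ := hC
  refine ⟨?_, u, orbit_trans (cut_mem_orbit hw) hu, huA⟩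
  have hCC := mem_orbit_self (cut w)
  have hLL := mem_orbit_self (left w)
  have hCcl : ∀ v ∈ orbit (cut w), left v ∈ orbit (cut w) ∧ right v ∈ orbit (cut w) :=
    fun v hv => ⟨left_mem_orbit (cut_mem hw) hv, right_mem_orbit (cut_mem hw) hv⟩
  obtain ha | ha := le_total (w.re ^ 2 + w.im ^ 2) (1 / 4)
  · have hL := (ih _ (left_mem hw) (im_left_of_short_side hw hm ha)).1
    refine (((Set.toFinite {w, right w}).union hL).union hfin).subset
      (orbit_subset (by simp) fun v hv => ?_)
    obtain ((rfl | rfl) | hv) | hv := hv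
    · simp [hLL]
    · exact children_mem_of_eq (children_right hw) (by simp) (by simp [hCC])
    · exact ⟨.inl (.inr (left_mem_orbit (left_mem hw) hv)),
        .inl (.inr (right_mem_orbit (left_mem hw) hv))⟩
    · exact ⟨.inr (hCcl v hv).1, .inr (hCcl v hv).2⟩
  · refine ((Set.toFinite {w, left w, right w}).union hfin).subset
      (orbit_subset (by simp) fun v hv => ?_)
    obtain (rfl | rfl | rfl) | hv := hv
    · simp
    · exact children_mem_of_eq (children_left hw (ha.trans hm) ha) (by simp [hCC]) (by simp)
    · exact children_mem_of_eq (children_right hw) (by simp) (by simp [hCC])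
    · exact ⟨.inr (hCcl v hv).1, .inr (hCcl v hv).2⟩

end LongestEdgeBisection

/-! ### The Markov chain on similarity classes -/

namespace LongestEdgeBisection

/-- The averaging operator `f ↦ (f ∘ L + f ∘ R) / 2` on functions of similarity classes. Since both
halves of a triangle have the same area, `(avg ^ j) f w` is the area-weighted mean of `f` over
the classes that `j` bisection steps produce from a triangle of class `w`. -/
noncomputable def avg : Module.End ℝ (ℂ → ℝ) where
  toFun f w := (f (left w) + f (right w)) / 2
  map_add' f g := by ext w; simp only [Pi.add_apply]; ring
  map_smul' a f := by ext w; simp only [Pi.smul_apply, smul_eq_mul, RingHom.id_apply]; ring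

variable {z w u c : ℂ} {f g : ℂ → ℝ} {S T : Set ℂ}

theorem avg_apply (f : ℂ → ℝ) (w : ℂ) : avg f w = (f (left w) + f (right w)) / 2 := rfl

theorem avg_pow_succ_apply (n : ℕ) (f : ℂ → ℝ) (w : ℂ) :
    (avg ^ (n + 1)) f w = ((avg ^ n) f (left w) + (avg ^ n) f (right w)) / 2 := by
  rw [pow_succ', Module.End.mul_apply, avg_apply]

theorem avg_pow_add_apply (m n : ℕ) (f : ℂ → ℝ) :
    (avg ^ (m + n)) f = (avg ^ m) ((avg ^ n) f) := by
  rw [pow_add, Module.End.mul_apply]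

theorem avg_eq_of_children {a b : ℂ} (h : s(left u, right u) = s(a, b)) (f : ℂ → ℝ) :
    avg f u = (f a + f b) / 2 := by
  obtain ⟨h1, h2⟩ | ⟨h1, h2⟩ := Sym2.eq_iff.1 h <;> rw [avg_apply, h1, h2]
  ring

theorem avg_pow_mono (hS : ∀ u ∈ S, left u ∈ S ∧ right u ∈ S) (h : ∀ u ∈ S, f u ≤ g u) (n : ℕ) :
    ∀ u ∈ S, (avg ^ n) f u ≤ (avg ^ n) g u := by
  induction n with
  | zero => simpa using h
  | succ n ih =>
    intro u hu
    rw [avg_pow_succ_apply, avg_pow_succ_apply]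
    linarith [ih _ (hS u hu).1, ih _ (hS u hu).2]

theorem avg_pow_mono' (h : ∀ u, f u ≤ g u) (n : ℕ) (u : ℂ) : (avg ^ n) f u ≤ (avg ^ n) g u :=
  avg_pow_mono (S := Set.univ) (by simp) (by simpa using h) n u trivial

theorem avg_pow_congr (hS : ∀ u ∈ S, left u ∈ S ∧ right u ∈ S) (h : ∀ u ∈ S, f u = g u) (n : ℕ)
    (hu : u ∈ S) : (avg ^ n) f u = (avg ^ n) g u :=
  le_antisymm (avg_pow_mono hS (fun v hv => (h v hv).le) n u hu)
    (avg_pow_mono hS (fun v hv => (h v hv).ge) n u hu)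

theorem avg_pow_const (a : ℝ) (n : ℕ) (u : ℂ) : (avg ^ n) (fun _ => a) u = a := by
  induction n generalizing u with
  | zero => simp
  | succ n ih => rw [avg_pow_succ_apply, ih, ih]; ring

theorem indicator_one_nonneg (S : Set ℂ) (u : ℂ) : (0 : ℝ) ≤ S.indicator 1 u :=
  Set.indicator_nonneg (fun _ _ => zero_le_one) u

theorem indicator_one_le_one (S : Set ℂ) (u : ℂ) : S.indicator 1 u ≤ (1 : ℝ) :=
  Set.indicator_le_self' (fun _ _ => zero_le_one) u

theorem avg_pow_nonneg (hf : ∀ u, 0 ≤ f u) (n : ℕ) (u : ℂ) : 0 ≤ (avg ^ n) f u := by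
  simpa only [avg_pow_const] using avg_pow_mono' hf n u

theorem avg_pow_le_one (hf : ∀ u, f u ≤ 1) (n : ℕ) (u : ℂ) : (avg ^ n) f u ≤ 1 := by
  simpa only [avg_pow_const] using avg_pow_mono' hf n u

theorem avg_pow_indicator_compl_eq_zero (hT : ∀ u ∈ T, left u ∈ T ∧ right u ∈ T) (n : ℕ)
    (hu : u ∈ T) : (avg ^ n) (Tᶜ.indicator 1) u = 0 := by
  rw [avg_pow_congr hT (g := fun _ => 0) (fun v hv => by simp [hv]) n hu, avg_pow_const]

theorem antitone_avg_pow_indicator_compl (hT : ∀ u ∈ T, left u ∈ T ∧ right u ∈ T) (u : ℂ) :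
    Antitone fun n => (avg ^ n) (Tᶜ.indicator 1) u := by
  refine antitone_nat_of_succ_le fun n => ?_
  rw [avg_pow_add_apply]
  refine avg_pow_mono' (fun v => ?_) n u
  by_cases hv : v ∈ T
  · rw [avg_pow_indicator_compl_eq_zero hT 1 hv]; exact indicator_one_nonneg _ v
  · rw [Set.indicator_of_mem hv]; exact avg_pow_le_one (indicator_one_le_one _) 1 v

/-- If every class of a finite set closed under `L` and `R` has a descendant in the closed set `T`,
then the mass outside `T` decays exponentially. -/
theorem exists_geometric_bound (hSfin : S.Finite) (hS : ∀ u ∈ S, left u ∈ S ∧ right u ∈ S)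
    (hT : ∀ u ∈ T, left u ∈ T ∧ right u ∈ T)
    (hST : ∀ u ∈ S, ∃ n, (avg ^ n) (Tᶜ.indicator 1) u < 1) :
    ∃ ξ ∈ Set.Ioo (0 : ℝ) 1, ∃ C : ℝ, ∀ j, ∀ u ∈ S,
      (avg ^ j) (Tᶜ.indicator 1) u ≤ C * ξ ^ j := by
  have hanti := antitone_avg_pow_indicator_compl hT
  set N : ℂ → ℝ := Tᶜ.indicator 1 with hN
  obtain ⟨n, hn, hn0⟩ : ∃ n, (∀ u ∈ S, (avg ^ n) N u < 1) ∧ 0 < n := by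
    refine (((Set.Finite.eventually_all hSfin).2 fun u hu => ?_).and (eventually_gt_atTop 0)).exists
      (f := atTop)
    obtain ⟨n, hn⟩ := hST u hu
    filter_upwards [eventually_ge_atTop n] with m hm using (hanti u hm).trans_lt hn
  obtain ⟨θ, hθ, hθ01⟩ : ∃ θ : ℝ, (∀ u ∈ S, (avg ^ n) N u ≤ θ) ∧ θ ∈ Set.Ioo (0 : ℝ) 1 := by
    refine (((Set.Finite.eventually_all hSfin).2 fun u hu => ?_).and
      (Ioo_mem_nhdsLT one_pos)).exists (f := 𝓝[<] (1 : ℝ))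
    filter_upwards [Ioo_mem_nhdsLT (hn u hu)] with θ h using h.1.le
  have hstep : ∀ u ∈ S, (avg ^ n) N u ≤ (θ • N) u := by
    intro u hu
    by_cases huT : u ∈ T
    · rw [avg_pow_indicator_compl_eq_zero hT n huT]
      exact mul_nonneg hθ01.1.le (indicator_one_nonneg _ u)
    · simpa [hN, huT] using hθ u hu
  have hpow : ∀ k, ∀ u ∈ S, (avg ^ (n * k)) N u ≤ θ ^ k := by
    intro k
    induction k with
    | zero => intro u _; simpa using indicator_one_le_one _ u
    | succ k ih =>
      intro u hu
      calc (avg ^ (n * (k + 1))) N u = (avg ^ (n * k)) ((avg ^ n) N) u := by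
            rw [mul_add, mul_one, avg_pow_add_apply]
        _ ≤ (avg ^ (n * k)) (θ • N) u := avg_pow_mono hS hstep _ u hu
        _ = θ * (avg ^ (n * k)) N u := by rw [map_smul]; rfl
        _ ≤ θ * θ ^ k := mul_le_mul_of_nonneg_left (ih u hu) hθ01.1.le
        _ = θ ^ (k + 1) := by ring
  have hξn : (θ ^ (n : ℝ)⁻¹) ^ n = θ := Real.rpow_inv_natCast_pow hθ01.1.le hn0.ne'
  have hξ0 : 0 < θ ^ (n : ℝ)⁻¹ := Real.rpow_pos_of_pos hθ01.1 _
  have hξ1 : θ ^ (n : ℝ)⁻¹ < 1 := Real.rpow_lt_one hθ01.1.le hθ01.2 (by positivity)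
  generalize θ ^ (n : ℝ)⁻¹ = ξ at *
  refine ⟨ξ, ⟨hξ0, hξ1⟩, θ⁻¹, fun j u hu => ?_⟩
  calc (avg ^ j) N u ≤ (avg ^ (n * (j / n))) N u := hanti u (Nat.mul_div_le j n)
    _ ≤ θ ^ (j / n) := hpow _ u hu
    _ = θ⁻¹ * (ξ ^ (n * (j / n)) * ξ ^ n) := by
      have := hθ01.1
      rw [pow_mul, hξn]; field_simp
    _ ≤ θ⁻¹ * (ξ ^ (n * (j / n)) * ξ ^ (j % n)) := by
      refine mul_le_mul_of_nonneg_left (mul_le_mul_of_nonneg_left ?_ (by positivity))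
        (inv_pos.2 hθ01.1).le
      exact pow_le_pow_of_le_one hξ0.le hξ1.le (Nat.mod_lt j hn0).le
    _ = θ⁻¹ * ξ ^ j := by rw [← pow_add, Nat.div_add_mod]

/-- On a terminal quadruple `u, L(u), R(u), V`, two bisection steps average over the pair `u, V` or
over the pair `L(u), R(u)`. -/
theorem exists_avg_sq_of_mem_regionI (hu : u ∈ regionI) (hc : c ∈ orbit u) :
    ∃ a b, (c = a ∨ c = b) ∧ ∀ x, x = a ∨ x = b → ∀ f, (avg ^ 2) f x = (f a + f b) / 2 := by
  obtain ⟨hD, hx, hm⟩ := mem_regionI_iff.1 hu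
  have hL := avg_eq_of_children (children_left hD hx (hx.trans hm))
  have hR := avg_eq_of_children (children_right hD)
  have hV := avg_eq_of_children (children_cut hD hm)
  have h1 : ∀ x, x = u ∨ x = cut u → ∀ f, (avg ^ 2) f x = (f u + f (cut u)) / 2 := by
    rintro x (rfl | rfl) f <;> rw [pow_two, Module.End.mul_apply]
    · rw [avg_apply, hL, hR]; ring
    · rw [hV, hL, hR]; ring
  have h2 : ∀ x, x = left u ∨ x = right u →
      ∀ f, (avg ^ 2) f x = (f (left u) + f (right u)) / 2 := by
    rintro x (rfl | rfl) f <;> rw [pow_two, Module.End.mul_apply]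
    · rw [hL, hV, avg_apply]; ring
    · rw [hR, hV, avg_apply]; ring
  obtain rfl | rfl | rfl | rfl := orbit_subset_of_mem_regionI hu hc
  · exact ⟨_, _, Or.inl rfl, h1⟩
  · exact ⟨_, _, Or.inl rfl, h2⟩
  · exact ⟨_, _, Or.inr rfl, h2⟩
  · exact ⟨_, _, Or.inr rfl, h1⟩

theorem avg_pow_four_of_mem_regionI (hu : u ∈ regionI) (hc : c ∈ orbit u) (f : ℂ → ℝ) :
    (avg ^ 4) f c = (avg ^ 2) f c := by
  obtain ⟨a, b, hab, h⟩ := exists_avg_sq_of_mem_regionI hu hc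
  rw [show 4 = 2 + 2 from rfl, avg_pow_add_apply, h c hab, h c hab, h a (.inl rfl), h b (.inr rfl)]
  ring

theorem half_le_avg_sq_of_mem_regionI (hu : u ∈ regionI) (hc : c ∈ orbit u) (hf : ∀ u, 0 ≤ f u) :
    f c / 2 ≤ (avg ^ 2) f c := by
  obtain ⟨a, b, hab, h⟩ := exists_avg_sq_of_mem_regionI hu hc
  rw [h c hab]
  obtain rfl | rfl := hab
  · linarith [hf b]
  · linarith [hf a]

theorem exists_regionI_of_mem_terminalClasses (hc : c ∈ terminalClasses z) :
    ∃ u ∈ regionI, c ∈ orbit u := by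
  obtain ⟨_, ⟨u, -, hu | ⟨v, hv, hvu⟩, rfl⟩, hc⟩ := hc
  · exact ⟨u, hu, hc⟩
  · exact ⟨v, hv, orbit_trans ((mem_orbit_self v).tail (Or.inr hvu)) hc⟩

theorem mem_terminalClasses_iff :
    c ∈ terminalClasses z ↔ ∃ u ∈ orbit z, u ∈ terminalRegion ∧ c ∈ orbit u := by
  constructor
  · rintro ⟨_, ⟨u, hu, huA, rfl⟩, hc⟩
    exact ⟨u, hu, huA, hc⟩
  · rintro ⟨u, hu, huA, hc⟩
    exact ⟨_, ⟨u, hu, huA, rfl⟩, hc⟩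

theorem terminalClasses_closed (hz : z ∈ normalizedRegion) :
    ∀ u ∈ terminalClasses z, left u ∈ terminalClasses z ∧ right u ∈ terminalClasses z := by
  intro c hc
  obtain ⟨u, hu, huA, hc⟩ := mem_terminalClasses_iff.1 hc
  have hD := mem_normalizedRegion_of_mem_orbit hz hu
  exact ⟨mem_terminalClasses_iff.2 ⟨u, hu, huA, left_mem_orbit hD hc⟩,
    mem_terminalClasses_iff.2 ⟨u, hu, huA, right_mem_orbit hD hc⟩⟩

/-- Mass escapes from `w` into `T` if some descendant of `w` lies in `T`. -/
theorem exists_avg_pow_indicator_compl_lt_one (hu : u ∈ orbit w) (huT : u ∈ T) :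
    ∃ n, (avg ^ n) (Tᶜ.indicator 1) w < 1 := by
  induction hu using Relation.ReflTransGen.head_induction_on with
  | refl => exact ⟨0, by simp [huT]⟩
  | @head x y h _ ih =>
    obtain ⟨n, hn⟩ := ih
    refine ⟨n + 1, ?_⟩
    rw [avg_pow_succ_apply]
    have h1 := avg_pow_le_one (indicator_one_le_one Tᶜ) n
    obtain h | h := h
    · rw [← h.shape_eq] at hn
      linarith [h1 (right x), show (avg ^ n) _ (left x) < 1 from hn]
    · rw [← h.shape_eq] at hn
      linarith [h1 (left x), show (avg ^ n) _ (right x) < 1 from hn]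

theorem exists_avg_pow_indicator_pos (hc : c ∈ orbit w) :
    ∃ n, 0 < (avg ^ n) (Set.indicator {c} 1) w := by
  induction hc using Relation.ReflTransGen.head_induction_on with
  | refl => exact ⟨0, by simp⟩
  | @head x y h _ ih =>
    obtain ⟨n, hn⟩ := ih
    refine ⟨n + 1, ?_⟩
    rw [avg_pow_succ_apply]
    have h1 := avg_pow_nonneg (indicator_one_nonneg {c}) n
    obtain h | h := h
    · rw [← h.shape_eq] at hn
      linarith [h1 (right x), show 0 < (avg ^ n) _ (left x) from hn]
    · rw [← h.shape_eq] at hn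
      linarith [h1 (left x), show 0 < (avg ^ n) _ (right x) from hn]

theorem exists_geometric_bound_terminalClasses (hz : z ∈ normalizedRegion) :
    ∃ ξ ∈ Set.Ioo (0 : ℝ) 1, ∃ C : ℝ, ∀ j,
      (avg ^ j) ((terminalClasses z)ᶜ.indicator 1) z ≤ C * ξ ^ j := by
  obtain ⟨ξ, hξ, C, h⟩ := exists_geometric_bound (terminates hz).1
    (fun u hu => ⟨left_mem_orbit hz hu, right_mem_orbit hz hu⟩) (terminalClasses_closed hz)
    fun w hw => by
      obtain ⟨-, u, hu, huA⟩ := terminates (mem_normalizedRegion_of_mem_orbit hz hw)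
      exact exists_avg_pow_indicator_compl_lt_one hu
        (mem_terminalClasses_iff.2 ⟨u, orbit_trans hw hu, huA, mem_orbit_self u⟩)
  exact ⟨ξ, hξ, C, fun j => h j z (mem_orbit_self z)⟩

theorem half_indicator_le_avg_pow (hc : c ∈ terminalClasses z) (n : ℕ) :
    ∀ u, ((1 / 2 : ℝ) • Set.indicator {c} 1) u ≤ (avg ^ (2 * n)) (Set.indicator {c} 1) u := by
  obtain ⟨v, hv, hcv⟩ := exists_regionI_of_mem_terminalClasses hc
  have hf := indicator_one_nonneg {c}
  have hn : (1 / 2 : ℝ) ≤ (avg ^ (2 * n)) (Set.indicator {c} 1) c := by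
    match n with
    | 0 => norm_num
    | n + 1 =>
      induction n with
      | zero =>
        have := half_le_avg_sq_of_mem_regionI hv hcv hf
        simpa using this
      | succ n ih =>
        have hcl : ∀ u ∈ orbit v, left u ∈ orbit v ∧ right u ∈ orbit v := fun u hu =>
          ⟨left_mem_orbit (mem_regionI_iff.1 hv).1 hu, right_mem_orbit (mem_regionI_iff.1 hv).1 hu⟩
        rw [show 2 * (n + 1 + 1) = 2 * n + 4 by ring, avg_pow_add_apply,
          avg_pow_congr hcl (fun u hu => avg_pow_four_of_mem_regionI hv hu _) _ hcv,
          ← avg_pow_add_apply]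
        exact ih
  intro u
  by_cases h : u = c
  · subst h; simpa using hn
  · simpa [h] using avg_pow_nonneg hf (2 * n) u

/-- Along steps of one parity the share of each class converges. On terminal classes four steps act
like two steps, so consecutive differences are bounded by the nonterminal mass. -/
theorem exists_limit_avg_pow (hz : z ∈ normalizedRegion) (c : ℂ) (s : ℕ) :
    ∃ l : ℝ, Tendsto (fun j => (avg ^ (2 * j + s)) (Set.indicator {c} 1) z) atTop (𝓝 l) ∧
      (l ≠ 0 ↔ c ∈ terminalClasses z ∧
        ∃ k, (avg ^ (2 * k + s)) (Set.indicator {c} 1) z ≠ 0) := by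
  obtain ⟨ξ, ⟨hξ0, hξ1⟩, C, hb⟩ := exists_geometric_bound_terminalClasses hz
  have hf0 := indicator_one_nonneg {c}
  have hf1 := indicator_one_le_one {c}
  set f : ℂ → ℝ := Set.indicator {c} 1 with hf
  set N : ℂ → ℝ := (terminalClasses z)ᶜ.indicator 1 with hN
  have hdiff : ∀ u, |(avg ^ 4) f u - (avg ^ 2) f u| ≤ N u := by
    intro u
    by_cases hu : u ∈ terminalClasses z
    · obtain ⟨v, hv, huv⟩ := exists_regionI_of_mem_terminalClasses hu
      rw [avg_pow_four_of_mem_regionI hv huv, sub_self, abs_zero]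
      exact indicator_one_nonneg _ u
    · rw [hN, Set.indicator_of_mem hu, Pi.one_apply, abs_le]
      constructor <;> linarith [avg_pow_nonneg hf0 4 u, avg_pow_nonneg hf0 2 u,
        avg_pow_le_one hf1 4 u, avg_pow_le_one hf1 2 u]
  have hcauchy : CauchySeq fun j => (avg ^ (2 * (j + 1) + s)) f z := by
    refine cauchySeq_of_le_geometric (ξ ^ 2) (C * ξ ^ s) (by nlinarith) fun j => ?_
    have e1 : (avg ^ (2 * (j + 1) + s)) f = (avg ^ (2 * j + s)) ((avg ^ 2) f) := by
      rw [← avg_pow_add_apply]; ring_nf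
    have e2 : (avg ^ (2 * (j + 1 + 1) + s)) f = (avg ^ (2 * j + s)) ((avg ^ 4) f) := by
      rw [← avg_pow_add_apply]; ring_nf
    have e3 : C * ξ ^ s * (ξ ^ 2) ^ j = C * ξ ^ (2 * j + s) := by ring
    rw [dist_comm, Real.dist_eq, e1, e2, ← Pi.sub_apply, ← map_sub, e3]
    refine le_trans ?_ (hb (2 * j + s))
    rw [abs_le]
    constructor
    · rw [← Pi.neg_apply, ← map_neg]
      exact avg_pow_mono' (fun u => (abs_le.1 (hdiff u)).1) _ z
    · exact avg_pow_mono' (fun u => (abs_le.1 (hdiff u)).2) _ z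
  obtain ⟨l, hl⟩ := cauchySeq_tendsto_of_complete hcauchy
  have hl' : Tendsto (fun j => (avg ^ (2 * j + s)) f z) atTop (𝓝 l) :=
    (tendsto_add_atTop_iff_nat (f := fun j => (avg ^ (2 * j + s)) f z) 1).1 hl
  refine ⟨l, hl', fun hl0 => ⟨?_, ?_⟩, fun ⟨hc, k, hk⟩ => ?_⟩
  · by_contra hc
    refine hl0 (tendsto_nhds_unique hl' (squeeze_zero (fun j => avg_pow_nonneg hf0 _ z)
      (fun j => (avg_pow_mono' (g := N) (fun u => ?_) _ z).trans (hb (2 * j + s))) ?_))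
    · by_cases hu : u = c
      · subst hu; simp [hf, hN, hc]
      · simpa [hf, hu] using indicator_one_nonneg _ u
    · rw [← mul_zero C]
      refine ((tendsto_pow_atTop_nhds_zero_of_lt_one hξ0.le hξ1).comp
        (tendsto_atTop_mono (fun j => ?_) tendsto_id)).const_mul C
      simp only [id]; lia
  · by_contra! h
    exact hl0 (tendsto_nhds_unique hl' (by simp [h]))
  · have hk0 : 0 < (avg ^ (2 * k + s)) f z := lt_of_le_of_ne (avg_pow_nonneg hf0 _ z) hk.symm
    have : (avg ^ (2 * k + s)) f z / 2 ≤ l := by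
      refine ge_of_tendsto hl' ?_
      filter_upwards [eventually_ge_atTop k] with j hj
      obtain ⟨n, rfl⟩ := Nat.exists_eq_add_of_le hj
      have h1 := avg_pow_mono' (half_indicator_le_avg_pow hc n) (2 * k + s) z
      rw [map_smul, ← avg_pow_add_apply, Pi.smul_apply, smul_eq_mul] at h1
      rw [show 2 * (k + n) + s = 2 * k + s + 2 * n by ring]
      linarith
    exact (lt_of_lt_of_le (half_pos hk0) this).ne'

theorem sum_avg_pow_indicator (hz : z ∈ normalizedRegion) (hfin : (orbit z).Finite) (j : ℕ) :
    ∑ c ∈ hfin.toFinset, (avg ^ j) (Set.indicator {c} 1) z = 1 := by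
  have h1 : ∑ c ∈ hfin.toFinset, (avg ^ j) (Set.indicator {c} 1) z =
      (avg ^ j) (∑ c ∈ hfin.toFinset, Set.indicator {c} 1) z := by
    rw [map_sum, Finset.sum_apply]
  rw [h1, avg_pow_congr (S := orbit z) (g := fun _ => 1)
    (fun u hu => ⟨left_mem_orbit hz hu, right_mem_orbit hz hu⟩) (fun u hu => ?_) j
    (mem_orbit_self z), avg_pow_const]
  rw [Finset.sum_apply, Finset.sum_eq_single_of_mem u (hfin.mem_toFinset.2 hu)]
  · simp
  · intro b _ hb
    simp [hb.symm]

end LongestEdgeBisection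

/-! ### Areas of mesh triangles -/

namespace LongestEdgeBisection

open scoped Pointwise

/-- The area of a triangle is a fixed multiple of the absolute value of its determinant. -/
theorem area_eq (T : Triangle) : area T = |signedDet T| * area ![0, 1, Complex.I] := by
  let f : ℂ →ₗ[ℝ] ℂ := Complex.reLm.smulRight (T 1 - T 0) + Complex.imLm.smulRight (T 2 - T 0)
  have hf : ∀ x, f x = x.re • (T 1 - T 0) + x.im • (T 2 - T 0) := fun _ => rfl
  have hdet : LinearMap.det f = signedDet T := by
    rw [← LinearMap.det_toMatrix Complex.basisOneI, Matrix.det_fin_two]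
    simp [LinearMap.toMatrix_apply, hf, signedDet]
    ring
  have hrange : Set.range T = T 0 +ᵥ f '' Set.range ![0, 1, Complex.I] := by
    rw [← Set.range_comp, ← Set.image_vadd, ← Set.range_comp]
    congr 1
    ext i
    fin_cases i <;> simp [hf]
  rw [area, area, hrange, convexHull_vadd, ← LinearMap.image_convexHull, measureReal_def,
    measureReal_def, measure_vadd, Measure.addHaar_image_linearMap, hdet, ENNReal.toReal_mul,
    ENNReal.toReal_ofReal (abs_nonneg _)]

theorem area_zero_one_I_pos : 0 < area ![0, 1, Complex.I] := by
  have hfin : volume (convexHull ℝ (Set.range ![0, 1, Complex.I])) ≠ ⊤ :=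
    ((Set.finite_range _).isCompact_convexHull ℝ).measure_lt_top.ne
  rw [area, measureReal_def, ENNReal.toReal_pos_iff]
  refine ⟨?_, hfin.lt_top⟩
  have hsub : Metric.ball (⟨1 / 4, 1 / 4⟩ : ℂ) (1 / 8) ⊆
      convexHull ℝ (Set.range ![0, 1, Complex.I]) := by
    intro x hx
    rw [Metric.mem_ball, dist_eq_norm] at hx
    have h1 := abs_le.1 ((Complex.abs_re_le_norm _).trans hx.le)
    have h2 := abs_le.1 ((Complex.abs_im_le_norm _).trans hx.le)
    simp only [Complex.sub_re, Complex.sub_im] at h1 h2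
    have hmem : ∀ i, ![0, 1, Complex.I] i ∈ convexHull ℝ (Set.range ![0, 1, Complex.I]) :=
      fun i => subset_convexHull ℝ _ ⟨i, rfl⟩
    have := (convex_convexHull ℝ (Set.range ![0, 1, Complex.I])).sum_mem (t := Finset.univ)
      (w := ![1 - x.re - x.im, x.re, x.im]) (z := ![0, 1, Complex.I])
      (by
        intro i _
        fin_cases i <;> simp <;> linarith)
      (by simp [Fin.sum_univ_three]; ring) (fun i _ => hmem i)
    convert this
    apply Complex.ext <;> simp [Fin.sum_univ_three]
  exact (Metric.measure_ball_pos volume _ (by norm_num)).trans_le (measure_mono hsub)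

theorem area_of_mem_bisect {T A : Triangle} {i : Fin 3} (hA : A ∈ bisect T i) :
    area A = area T / 2 := by
  suffices h : |signedDet A| = |signedDet T| / 2 by rw [area_eq A, area_eq T, h]; ring
  have h2 : signedDet A = signedDet T / 2 := by
    simp only [bisect, Multiset.insert_eq_cons, Multiset.mem_cons, Multiset.mem_singleton] at hA
    obtain rfl | rfl := hA <;> fin_cases i <;>
      simp [signedDet, midpoint_eq_smul_add, show (1 + 1 : Fin 3) = 2 from rfl,
        show (1 + 2 : Fin 3) = 0 from rfl, show (2 + 1 : Fin 3) = 0 from rfl,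
        show (2 + 2 : Fin 3) = 1 from rfl] <;> ring
  rw [h2, abs_div, abs_two]

theorem mesh_succ' (e : Triangle → Fin 3) (T : Triangle) (j : ℕ) :
    mesh e T (j + 1) = (bisect T (e T)).bind fun S => mesh e S j := by
  induction j with
  | zero =>
    have h := Multiset.bind_singleton (bisect T (e T)) id
    rw [Multiset.map_id] at h
    simp only [mesh, Multiset.singleton_bind]
    exact h.symm
  | succ j ih =>
    rw [mesh, ih, Multiset.bind_assoc]
    rfl

theorem areaOf_succ {e : Triangle → Fin 3} {T A B : Triangle} (h : bisect T (e T) = {A, B}) (j : ℕ)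
    (P : Triangle → Prop) : areaOf e T (j + 1) P = areaOf e A j P + areaOf e B j P := by
  simp only [areaOf, mesh_succ', h, Multiset.insert_eq_cons, Multiset.cons_bind,
    Multiset.singleton_bind, Multiset.filter_add, Multiset.map_add, Multiset.sum_add]

/-- The area occupied by the triangles of the mesh whose class lies in `X`. -/
theorem areaOf_eq_avg_pow {e : Triangle → Fin 3} (he : ∀ T, IsLongestEdge T (e T))
    {P : Triangle → Prop} {X : Set ℂ} (hP : ∀ T w, HasShape T w → (P T ↔ w ∈ X)) (j : ℕ)
    {T : Triangle} {w : ℂ} (hT : HasShape T w) :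
    areaOf e T j P = area T * (avg ^ j) (X.indicator 1) w := by
  induction j generalizing T w with
  | zero =>
    by_cases hw : w ∈ X
    · simp [areaOf, mesh, hw, Multiset.filter_singleton, (hP T w hT).2 hw]
    · simp [areaOf, mesh, hw, Multiset.filter_singleton, mt (hP T w hT).1 hw]
  | succ j ih =>
    obtain ⟨A, B, hAB, hA, hB⟩ := hT.bisect (he T)
    rw [areaOf_succ hAB, ih hA, ih hB, avg_pow_succ_apply,
      area_of_mem_bisect (T := T) (A := A) (i := e T) (by simp [hAB]),
      area_of_mem_bisect (T := T) (A := B) (i := e T) (by simp [hAB])]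
    ring

theorem area_pos {z : ℂ} (hz : z ∈ normalizedRegion) : 0 < area ![0, 1, z] := by
  rw [area_eq]
  exact mul_pos (abs_pos.2 (signedDet_ne_zero_of_im hz.2.1.ne')) area_zero_one_I_pos

theorem areaShare_eq_avg_pow {e : Triangle → Fin 3} (he : ∀ T, IsLongestEdge T (e T)) {z : ℂ}
    (hz : z ∈ normalizedRegion) (j : ℕ) (c : ℂ) :
    areaShare e z j c = (avg ^ j) (Set.indicator {c} 1) z := by
  rw [areaShare, areaOf_eq_avg_pow he (X := {c}) (fun T w hT => ?_) j (hasShape_self hz),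
    mul_div_cancel_left₀ _ (area_pos hz).ne']
  exact ⟨fun h => hT.unique h, fun h => by rwa [Set.mem_singleton_iff.1 h] at hT⟩

theorem nonterminalArea_eq_avg_pow {e : Triangle → Fin 3} (he : ∀ T, IsLongestEdge T (e T)) {z : ℂ}
    (hz : z ∈ normalizedRegion) (j : ℕ) : nonterminalArea e z j =
      area ![0, 1, z] * (avg ^ j) ((terminalClasses z)ᶜ.indicator 1) z := by
  refine areaOf_eq_avg_pow he (fun T w hT => not_congr ?_) j (hasShape_self hz)
  exact ⟨fun ⟨c, hc, h⟩ => hT.unique h ▸ hc, fun h => ⟨w, h, hT⟩⟩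

end LongestEdgeBisection

theorem theorem1p1 (z : ℂ) (hz : z ∈ LongestEdgeBisection.normalizedRegion)
    (e : LongestEdgeBisection.Triangle → Fin 3)
    (he : ∀ T, LongestEdgeBisection.IsLongestEdge T (e T)) :
    ∃ hfin : (LongestEdgeBisection.orbit z).Finite,
      (∀ j, (∀ c ∈ LongestEdgeBisection.orbit z,
          0 ≤ LongestEdgeBisection.areaShare e z j c) ∧
        ∑ c ∈ hfin.toFinset, LongestEdgeBisection.areaShare e z j c = 1) ∧
      (∃ wEven wOdd : LongestEdgeBisection.orbit z → ℝ,
        Tendsto (fun j (c : LongestEdgeBisection.orbit z) =>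
          LongestEdgeBisection.areaShare e z (2 * j) c) atTop (𝓝 wEven) ∧
        Tendsto (fun j (c : LongestEdgeBisection.orbit z) =>
          LongestEdgeBisection.areaShare e z (2 * j + 1) c) atTop (𝓝 wOdd) ∧
        (∀ c : LongestEdgeBisection.orbit z, (wEven c ≠ 0 ∨ wOdd c ≠ 0) ↔
          (c : ℂ) ∈ LongestEdgeBisection.terminalClasses z) ∧
        (∀ c : LongestEdgeBisection.orbit z, wEven c ≠ 0 ↔
          (c : ℂ) ∈ LongestEdgeBisection.terminalClasses z ∧
            ∃ k, LongestEdgeBisection.areaShare e z (2 * k) c ≠ 0) ∧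
        (∀ c : LongestEdgeBisection.orbit z, wOdd c ≠ 0 ↔
          (c : ℂ) ∈ LongestEdgeBisection.terminalClasses z ∧
            ∃ k, LongestEdgeBisection.areaShare e z (2 * k + 1) c ≠ 0)) ∧
      (∃ ξ ∈ Set.Ioo (0 : ℝ) 1, ∃ C : ℝ, ∀ j : ℕ,
        LongestEdgeBisection.nonterminalArea e z j ≤ C * ξ ^ j) := by
  open LongestEdgeBisection in
  have hfin := (terminates hz).1
  simp only [areaShare_eq_avg_pow he hz, nonterminalArea_eq_avg_pow he hz]
  refine ⟨hfin, fun j => ⟨fun c _ => avg_pow_nonneg (indicator_one_nonneg _) j z,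
    sum_avg_pow_indicator hz hfin j⟩, ?_, ?_⟩
  · choose wEven hEven hEven' using fun c => exists_limit_avg_pow hz c 0
    choose wOdd hOdd hOdd' using fun c => exists_limit_avg_pow hz c 1
    refine ⟨fun c => wEven c, fun c => wOdd c, tendsto_pi_nhds.2 fun c => hEven c,
      tendsto_pi_nhds.2 fun c => hOdd c, fun c => ?_, fun c => hEven' c, fun c => hOdd' c⟩
    rw [hEven', hOdd', ← and_or_left, and_iff_left_iff_imp]
    intro _
    obtain ⟨n, hn⟩ := exists_avg_pow_indicator_pos c.2
    obtain ⟨k, rfl | rfl⟩ := Nat.even_or_odd' n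
    · exact Or.inl ⟨k, hn.ne'⟩
    · exact Or.inr ⟨k, hn.ne'⟩
  · obtain ⟨ξ, hξ, C, h⟩ := exists_geometric_bound_terminalClasses hz
    refine ⟨ξ, hξ, area ![0, 1, z] * C, fun j => ?_⟩
    rw [mul_assoc]
    exact mul_le_mul_of_nonneg_left (h j) (area_pos hz).le
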